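/- **Setting.** Consider a stochastic bandit with $N\ge 2$ arms. Arm $i$ has a reward distribution $\mathcal D_i$ on $\mathbb R$ with mean $\theta_i$, where $\theta_1>\theta_2\ge\cdots\ge\theta_N$. Put $\Delta_a:=\theta_1-\theta_a$ and $\Delta:=\Delta_2$. In round $t=1,2,\dots$ an arm $\pi_t$ is chosen on the basis of the past (and possibly of extra randomization); given the past and $\pi_t=i$, the reward $X_t$ has law $\mathcal D_i$. The regret is $\mathcal R(T):=T\theta_1-\mathbb E\big[\sum_{t=1}^T X_t\big]$. Let $N_i(t)$ and $p_i(t)$ be the number of pulls and the empirical mean reward of arm $i$ in rounds $1,\dots,t$. **Index.** Let $p(x;\eta)=A(x)e^{\eta x-F(\eta)}$, $\eta\in\mathcal N$, be a one-parameter exponential family of non-degenerate densities with respect to some reference measure, with $\mathcal N$ an open interval and $F$ twice differentiable on $\mathcal N$; then $\dot F$ is strictly increasing on $\mathcal N$. Let $\Theta\subseteq\dot F(\mathcal N)$ be a closed interval with least element $\underline\theta$, and let $[x]_\Theta$ be the value of $x$ clipped to $\Theta$. For $n,\alpha>0$ and $\nu\in\Theta$ define $$I(\nu,n,\alpha)=(n\nu+\alpha)\dot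 F^{-1}\big([\nu+\tfrac{\alpha}{n}]_\Theta\big)-n\nu\dot F^{-1}(\nu)-nF\big(\dot F^{-1}([\nu+\tfrac{\alpha}{n}]_\Theta)\big)+nF\big(\dot F^{-1}(\nu)\big),$$ $\xi(k;\nu):=I(\nu,k,1)$ for $k>0$, and $K^*(\theta',\theta''):=\inf\{k>0:\dot F^{-1}(\theta')>\xi(k;\theta'')\}$. RBMLE with bias $\alpha(\cdot)$ pulls an arm that has not been pulled yet as long as there is one; afterwards it chooses in round $t$ an arm $i$ that maximizes $I(p_i(t-1),N_i(t-1),\alpha(t))$, with ties broken arbitrarily. **Rewards.** The rewards need not come from the exponential family. Assume that every $\mathcal D_i$ is supported in $\Theta$ and is $(\rho,\kappa)$-sub-exponential with $\rho,\kappa\ge0$, i.e. for $Y\sim\mathcal D_i$, $\mathbb E[e^{\lambda(Y-\theta_i)}]\le e^{\rho^2\lambda^2/2}$ for all real $\lambda$ with $\kappa|\lambda|<1$. **Proposition.** Let $\varepsilon\in(0,1)$ and let the arms be chosen by RBMLE with $\alpha(t)=C_\alpha\log t$, where $C_\alpha>0$ and $$C_\alpha\ \ge\ \frac{16(\kappa\varepsilon\Delta+2\rho^2)}{(\varepsilon\Delta)^2\,K^*(\theta_1-\frac{\varepsilon\Delta}{2},\underline\theta)}.$$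 Then for every $T\ge1$ $$\mathcal R(T)\le\sum_{a=2}^N\Delta_a\Big[\tilde Q_a(T)+\frac{\pi^2}{3}\Big],$$ $$\tilde Q_a(T):=\max\Big\{\frac{16(\kappa\varepsilon\Delta+2\rho^2)}{(\varepsilon\Delta_a)^2},\ C_\alpha K^*\big(\theta_1-\tfrac{\varepsilon}{2}\Delta_a,\ \theta_a+\tfrac{\varepsilon}{2}\Delta_a\big)\Big\}\log T+1 .$$ In particular $\mathcal R(T)=O(\log T)$ as $T\to\infty$. -/

import Mathlib

open MeasureTheory Filter Asymptotics

noncomputable section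

namespace RBMLE

/-- A one-parameter exponential family in canonical form: the densities
`p(x; η) = A x * exp (η * x - F η)`, `η ∈ param`, with respect to a reference measure `base`
(Lebesgue or counting measure, for instance). The parameter space is an open interval, `F` is twice
differentiable on it, and the laws are not concentrated at a single point. -/
structure ExpFamily where
  base : Measure ℝ
  A : ℝ → ℝ
  F : ℝ → ℝ
  param : Set ℝ
  measurable_A : Measurable A
  A_nonneg : ∀ x, 0 ≤ A x
  isOpen_param : IsOpen param
  ordConnected_param : param.OrdConnected
  nonempty_param : param.Nonempty
  differentiableOn_F : DifferentiableOn ℝ F param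
  differentiableOn_deriv_F : DifferentiableOn ℝ (deriv F) param
  integrable_density : ∀ η ∈ param, Integrable (fun x => A x * Real.exp (η * x - F η)) base
  integral_density : ∀ η ∈ param, ∫ x, A x * Real.exp (η * x - F η) ∂base = 1
  nondegenerate : ∀ c : ℝ, ¬ ∀ᵐ x ∂base, A x = 0 ∨ x = c

namespace ExpFamily

variable (E : ExpFamily)

/-- The set of means `F' η` of the members of the family. -/
def meanSpace : Set ℝ := deriv E.F '' E.param

/-- The inverse of `F' : param → meanSpace`: the canonical parameter with a given mean. -/
def invMean (θ : ℝ) : ℝ := Function.invFunOn (deriv E.F) E.param θ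

end ExpFamily

open Classical in
/-- The value of `x` clipped to the interval `Θ`. -/
def clip (Θ : Set ℝ) (x : ℝ) : ℝ :=
  if x ∈ Θ then x else if ∀ y ∈ Θ, y ≤ x then sSup Θ else sInf Θ

namespace ExpFamily

variable (E : ExpFamily) (Θ : Set ℝ)

/-- The RBMLE index `I(ν, n, α)`. -/
def index (ν n α : ℝ) : ℝ :=
  (n * ν + α) * E.invMean (clip Θ (ν + α / n)) - n * ν * E.invMean ν
    - n * E.F (E.invMean (clip Θ (ν + α / n))) + n * E.F (E.invMean ν)

/-- The function `ξ(k; ν)`, with the same clipping as in the index, so that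
`I(ν, k α, α) = α ξ(k; ν)`. -/
def xi (k ν : ℝ) : ℝ :=
  k * ((ν + 1 / k) * E.invMean (clip Θ (ν + 1 / k)) - ν * E.invMean ν)
    - k * (E.F (E.invMean (clip Θ (ν + 1 / k))) - E.F (E.invMean ν))

/-- `K*(θ', θ'') = inf {k > 0 : F'⁻¹(θ') > ξ(k; θ'')}`. -/
def Kstar (θ' θ'' : ℝ) : ℝ :=
  sInf {k : ℝ | 0 < k ∧ E.xi Θ k θ'' < E.invMean θ'}

end ExpFamily

/-- The law `μ` is `(ρ, κ)`-sub-exponential: `E[exp (l (Y - E Y))] ≤ exp (ρ² l² / 2)` for all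
`|l| < 1/κ` (for all real `l` if `κ = 0`). -/
def IsSubExponential (μ : Measure ℝ) (ρ κ : ℝ) : Prop :=
  Integrable (fun x => x) μ ∧
  ∀ l : ℝ, κ * |l| < 1 →
    Integrable (fun x => Real.exp (l * (x - ∫ y, y ∂μ))) μ ∧
    ∫ x, Real.exp (l * (x - ∫ y, y ∂μ)) ∂μ ≤ Real.exp (ρ ^ 2 * l ^ 2 / 2)

section Bandit

variable {N : ℕ} {Ω : Type*} [MeasurableSpace Ω]

/-- The mean reward `θ_i` of arm `i`. -/
def armMean (D : Fin N → Measure ℝ) (i : Fin N) : ℝ := ∫ x, x ∂(D i)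

/-- Interaction with a stochastic bandit with reward laws `D i`. Rounds are `1, 2, …`; in round `t`
the arm `arm t` is pulled and the reward `X t` is received. The arm is chosen on the basis of the
past `ℱ (t - 1)` (which may contain randomization of the policy), and given that past, the reward
has law `D i` if arm `i` is chosen. -/
structure IsBandit (P : Measure Ω) (ℱ : Filtration ℕ (inferInstance : MeasurableSpace Ω))
    (D : Fin N → Measure ℝ) (arm : ℕ → Ω → Fin N) (X : ℕ → Ω → ℝ) : Prop where
  measurable_arm : ∀ t, Measurable[ℱ t] (arm (t + 1))
  measurable_reward : ∀ t, Measurable[ℱ (t + 1)] (X (t + 1))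
  reward_law : ∀ (t : ℕ) (i : Fin N) (H : Set Ω) (B : Set ℝ),
    MeasurableSet[ℱ t] H → MeasurableSet B →
    P (H ∩ {ω | arm (t + 1) ω = i ∧ X (t + 1) ω ∈ B})
      = P (H ∩ {ω | arm (t + 1) ω = i}) * D i B

/-- `N_i(t)`: the number of pulls of arm `i` in rounds `1, …, t`. -/
def pulls (arm : ℕ → Ω → Fin N) (i : Fin N) (t : ℕ) (ω : Ω) : ℕ :=
  ((Finset.Icc 1 t).filter (fun s => arm s ω = i)).card

/-- `S_i(t)`: the total reward collected from arm `i` in rounds `1, …, t`. -/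
def totalReward (arm : ℕ → Ω → Fin N) (X : ℕ → Ω → ℝ) (i : Fin N) (t : ℕ) (ω : Ω) : ℝ :=
  ∑ s ∈ (Finset.Icc 1 t).filter (fun s => arm s ω = i), X s ω

/-- `p_i(t) = S_i(t) / N_i(t)`. -/
def empMean (arm : ℕ → Ω → Fin N) (X : ℕ → Ω → ℝ) (i : Fin N) (t : ℕ) (ω : Ω) : ℝ :=
  totalReward arm X i t ω / (pulls arm i t ω : ℝ)

/-- The arms are chosen by RBMLE with bias `α`, along the sample path `ω`: as long as some arm has
not been pulled, such an arm is pulled; afterwards, in round `t + 1`, an arm of maximal index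
(ties broken arbitrarily) is pulled. -/
def FollowsRBMLE (E : ExpFamily) (Θ : Set ℝ) (α : ℕ → ℝ) (arm : ℕ → Ω → Fin N)
    (X : ℕ → Ω → ℝ) (ω : Ω) : Prop :=
  ∀ t : ℕ,
    ((∃ i, pulls arm i t ω = 0) → pulls arm (arm (t + 1) ω) t ω = 0) ∧
    ((∀ i, pulls arm i t ω ≠ 0) → ∀ i,
      E.index Θ (empMean arm X i t ω) (pulls arm i t ω) (α (t + 1)) ≤
        E.index Θ (empMean arm X (arm (t + 1) ω) t ω) (pulls arm (arm (t + 1) ω) t ω)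
          (α (t + 1)))

/-- The regret `T θ* - E[∑_{t=1}^T X_t]`, where `best` is an optimal arm. -/
def regret (P : Measure Ω) (D : Fin N → Measure ℝ) (X : ℕ → Ω → ℝ) (best : Fin N) (T : ℕ) : ℝ :=
  T * armMean D best - ∫ ω, ∑ t ∈ Finset.Icc 1 T, X t ω ∂P

end Bandit

/-- The quantity `Q̃_a(T)`, where `θ₁` is the largest mean, `Δ` the minimum gap, `θa` the mean of
arm `a` and `θ₁ - θa` its gap. -/
def Qtilde (E : ExpFamily) (Θ : Set ℝ) (ρ κ ε Cα θ₁ Δ θa : ℝ) (T : ℕ) : ℝ :=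
  max (16 * (κ * ε * Δ + 2 * ρ ^ 2) / (ε * (θ₁ - θa)) ^ 2)
    (Cα * E.Kstar Θ (θ₁ - ε / 2 * (θ₁ - θa)) (θa + ε / 2 * (θ₁ - θa))) * Real.log T + 1

end RBMLE

end

/-! By Wald's identity the regret is the sum over arms of the gap times the expected number of pulls
(`regret_eq`), so it suffices to bound the latter for each suboptimal arm `a` (`integral_pulls_le`).

Deterministic part. With `k = n / α` the index is `α * ξ(k; ν)`, and `ξ(k; ν)` is the maximum of `η
- k * divergence ν η` over the canonical parameters `η` with mean in `Θ` (`xi_eq`, `le_xi`). Hence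
`ξ` decreases in `k`, increases in `ν` and is at least `invMean ν`, and `K*` is the threshold in `k`
at which `ξ` falls below a given level. Put `x = εΔ_a/2` and `y = εΔ/2`. If `a` has more than `Cα
K*(θ₁ - x, θa + x) log t` pulls and an empirical mean of at most `θa + x`, its `ξ` lies below
`invMean (θ₁ - x)`. The best arm reaches that level in two cases: when its empirical mean is at
least `θ₁ - x`, and when it has few pulls. In the second case the lower bound on `Cα` keeps its `k`
below `K*(θ₁ - y, θlow)`, so the bias alone lifts the index, whatever the data. Pulling `a`
therefore forces a deviation of one of two well-sampled means (`FollowsRBMLE.mem_deviationEvent`).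

Probabilistic part. `exp (l (S - Nθ) - N ρ² l² / 2)` has expectation at most one
(`lintegral_exp_le`). A single `l` serves all large `N`, so Markov's inequality bounds each
deviation in round `t` by `1/t²` without a union bound over `N`. Two such series sum to at most
`π²/3`. -/

namespace RBMLE

/-! ### Convexity of the log-partition function and its Bregman divergence. -/

namespace ExpFamily

variable (E : ExpFamily)

lemma convex_param : Convex ℝ E.param := E.ordConnected_param.convex

/-- The log-partition function is strictly convex: the densities satisfy the weighted
arithmetic-geometric mean inequality, with equality a.e. only for laws concentrated at a point. -/
lemma strictConvexOn_F : StrictConvexOn ℝ E.param E.F := by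
  refine ⟨E.convex_param, fun x hx y hy hxy a b ha hb hab => ?_⟩
  have hz : a • x + b • y ∈ E.param := E.convex_param hx hy ha.le hb.le hab
  simp only [smul_eq_mul] at hz ⊢
  -- If strict convexity fails at `z`, the weighted sum of the densities at `x` and `y` dominates
  -- the density at `z`, yet both have integral one. So the difference `g` vanishes a.e.
  by_contra! hδ
  set z := a * x + b * y with hzdef
  set g : ℝ → ℝ := fun t => a * (E.A t * Real.exp (x * t - E.F x)) +
    b * (E.A t * Real.exp (y * t - E.F y)) - E.A t * Real.exp (z * t - E.F z) with hg
  have hexp : ∀ t, Real.exp (z * t - E.F z) ≤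
      Real.exp (a * (x * t - E.F x) + b * (y * t - E.F y)) := fun t =>
    Real.exp_le_exp.2 (by rw [hzdef]; nlinarith)
  have hle : ∀ u v : ℝ, Real.exp (a * u + b * v) ≤ a * Real.exp u + b * Real.exp v :=
    fun u v => convexOn_exp.2 (Set.mem_univ u) (Set.mem_univ v) ha.le hb.le hab
  have hlt : ∀ u v : ℝ, u ≠ v → Real.exp (a * u + b * v) < a * Real.exp u + b * Real.exp v :=
    fun u v huv => strictConvexOn_exp.2 (Set.mem_univ u) (Set.mem_univ v) huv ha hb hab
  have hgt : ∀ t, g t = E.A t * (a * Real.exp (x * t - E.F x) + b * Real.exp (y * t - E.F y)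
      - Real.exp (z * t - E.F z)) := fun t => by simp only [hg]; ring
  have hg0 : 0 ≤ g := fun t => by
    rw [hgt]
    exact mul_nonneg (E.A_nonneg t) (by linarith [hexp t, hle (x * t - E.F x) (y * t - E.F y)])
  have hix := (E.integrable_density x hx).const_mul a
  have hiy := (E.integrable_density y hy).const_mul b
  have hiz := E.integrable_density z hz
  have hgi : Integrable g E.base := (hix.add hiy).sub hiz
  have hgI : ∫ t, g t ∂E.base = 0 := by
    have h1 := integral_sub (hix.add hiy) hiz
    have h2 := integral_add hix hiy
    simp only [Pi.add_apply] at h1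
    rw [h2, integral_const_mul, integral_const_mul, E.integral_density x hx,
      E.integral_density y hy, E.integral_density z hz] at h1
    rw [hg, h1]; linarith
  rw [integral_eq_zero_iff_of_nonneg hg0 hgi] at hgI
  -- Where `A t ≠ 0`, equality forces the two exponents to agree, which happens at this single point
  -- only.
  refine E.nondegenerate ((E.F x - E.F y) / (x - y)) ?_
  filter_upwards [hgI] with t ht
  by_contra! hne
  have huv : x * t - E.F x ≠ y * t - E.F y := fun h => hne.2 (by
    rw [eq_div_iff (sub_ne_zero.2 hxy)]; linarith)
  have := mul_pos (lt_of_le_of_ne (E.A_nonneg t) hne.1.symm)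
    (sub_pos.2 ((hexp t).trans_lt (hlt _ _ huv)))
  rw [← hgt, ht] at this
  exact lt_irrefl _ this

lemma differentiableAt_F {η : ℝ} (hη : η ∈ E.param) : DifferentiableAt ℝ E.F η :=
  E.differentiableOn_F.differentiableAt (E.isOpen_param.mem_nhds hη)

lemma strictMonoOn_deriv_F : StrictMonoOn (deriv E.F) E.param :=
  E.strictConvexOn_F.strictMonoOn_deriv fun _ hx => E.differentiableAt_F hx

/-- A convex function lies above its tangents. -/
lemma tangent_le {x y : ℝ} (hx : x ∈ E.param) (hy : y ∈ E.param) :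
    E.F x + deriv E.F x * (y - x) ≤ E.F y := by
  have hc := E.strictConvexOn_F.convexOn
  rcases lt_trichotomy x y with h | h | h
  · have := hc.deriv_le_slope hx hy h (E.differentiableAt_F hx)
    rw [slope_def_field, le_div_iff₀ (sub_pos.2 h)] at this
    linarith
  · simp [h]
  · have := hc.slope_le_deriv hy hx h (E.differentiableAt_F hx)
    rw [slope_def_field, div_le_iff₀ (sub_pos.2 h)] at this
    linarith

variable {E}

lemma invMean_mem {θ : ℝ} (h : θ ∈ E.meanSpace) : E.invMean θ ∈ E.param :=
  Function.invFunOn_mem h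

lemma deriv_invMean {θ : ℝ} (h : θ ∈ E.meanSpace) : deriv E.F (E.invMean θ) = θ :=
  Function.invFunOn_eq h

lemma invMean_strictMonoOn : StrictMonoOn E.invMean E.meanSpace := fun x hx y hy hxy => by
  rw [← E.strictMonoOn_deriv_F.lt_iff_lt (invMean_mem hx) (invMean_mem hy), deriv_invMean hx,
    deriv_invMean hy]
  exact hxy

lemma invMean_monotoneOn : MonotoneOn E.invMean E.meanSpace := invMean_strictMonoOn.monotoneOn

variable (E) in
/-- The Bregman divergence of `F` between the parameter `η` and the parameter with mean `ν`. -/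
noncomputable def divergence (ν η : ℝ) : ℝ :=
  E.F η - E.F (E.invMean ν) - ν * (η - E.invMean ν)

lemma divergence_nonneg {ν η : ℝ} (hν : ν ∈ E.meanSpace) (hη : η ∈ E.param) :
    0 ≤ E.divergence ν η := by
  have := E.tangent_le (invMean_mem hν) hη
  rw [deriv_invMean hν] at this
  unfold divergence; linarith

lemma divergence_self (ν : ℝ) : E.divergence ν (E.invMean ν) = 0 := by
  simp [divergence]

/-- Three-point identity: with `η₂ = invMean ν₂`, the difference of the two sides is `divergence ν₁
η₂ + (ν₂ - ν₁) (η - η₂)`. -/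
lemma divergence_anti {ν₁ ν₂ η : ℝ} (h₁ : ν₁ ∈ E.meanSpace) (h₂ : ν₂ ∈ E.meanSpace)
    (h : ν₁ ≤ ν₂) (hη : E.invMean ν₂ ≤ η) : E.divergence ν₂ η ≤ E.divergence ν₁ η := by
  have := E.tangent_le (invMean_mem h₁) (invMean_mem h₂)
  rw [deriv_invMean h₁] at this
  unfold divergence
  nlinarith [mul_nonneg (sub_nonneg.2 h) (sub_nonneg.2 hη)]

end ExpFamily

/-! ### Clipping from above. -/

section Clip

variable {Θ : Set ℝ}

lemma clip_of_mem {x : ℝ} (hx : x ∈ Θ) : clip Θ x = x := by simp [clip, hx]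

/-- Clipping a point above an element of `Θ` either does nothing or yields the maximum of `Θ`. -/
lemma clip_of_le (hI : Θ.OrdConnected) (hc : IsClosed Θ) {ν x : ℝ} (hν : ν ∈ Θ) (h : ν ≤ x) :
    clip Θ x ∈ Θ ∧ clip Θ x ≤ x ∧ (clip Θ x = x ∨ ∀ y ∈ Θ, y ≤ clip Θ x) := by
  by_cases hx : x ∈ Θ
  · simp [clip_of_mem hx, hx]
  · have hy : ∀ y ∈ Θ, y ≤ x := fun y hy => by
      by_contra! hxy
      exact hx (hI.out hν hy ⟨h, hxy.le⟩)
    have hb : BddAbove Θ := ⟨x, hy⟩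
    have : clip Θ x = sSup Θ := by rw [clip, if_neg hx, if_pos hy]
    rw [this]
    exact ⟨hc.csSup_mem ⟨ν, hν⟩ hb, csSup_le ⟨ν, hν⟩ hy, Or.inr fun y hy => le_csSup hb hy⟩

end Clip

/-! ### The function `ξ` and the threshold `K*`. -/

namespace ExpFamily

variable {E : ExpFamily} {Θ : Set ℝ}

lemma index_eq_mul_xi {ν n α : ℝ} (hn : n ≠ 0) (hα : α ≠ 0) :
    E.index Θ ν n α = α * E.xi Θ (n / α) ν := by
  unfold index xi
  rw [one_div_div]
  field_simp
  ring

lemma xi_eq {k ν : ℝ} (hk : 0 < k) : E.xi Θ k ν =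
    E.invMean (clip Θ (ν + 1 / k)) - k * E.divergence ν (E.invMean (clip Θ (ν + 1 / k))) := by
  unfold xi divergence
  have : k * (1 / k) = 1 := by field_simp
  linear_combination E.invMean (clip Θ (ν + 1 / k)) * this

section

variable (hS : Θ ⊆ E.meanSpace) (hI : Θ.OrdConnected) (hc : IsClosed Θ)

include hS hI hc

omit hS in
lemma clip_add_mem {k ν : ℝ} (hk : 0 < k) (hν : ν ∈ Θ) : clip Θ (ν + 1 / k) ∈ Θ :=
  (clip_of_le hI hc hν (by linarith [one_div_pos.2 hk])).1

/-- Variational characterization of `ξ`. -/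
lemma le_xi {k ν μ : ℝ} (hk : 0 < k) (hν : ν ∈ Θ) (hμ : μ ∈ Θ) :
    E.invMean μ - k * E.divergence ν (E.invMean μ) ≤ E.xi Θ k ν := by
  rw [xi_eq hk]
  obtain ⟨hm, hle, hor⟩ := clip_of_le hI hc hν
    (show ν ≤ ν + 1 / k by linarith [one_div_pos.2 hk])
  set c := clip Θ (ν + 1 / k)
  have ht := E.tangent_le (invMean_mem (hS hm)) (invMean_mem (hS hμ))
  rw [deriv_invMean (hS hm)] at ht
  -- First-order condition: the concave objective has slope `k (ν + 1/k - c)` at `invMean c`. This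
  -- is zero unless clipping is active, and then `c` is the maximum of `Θ`.
  have hcomp : 0 ≤ (ν + 1 / k - c) * (E.invMean c - E.invMean μ) := by
    rcases hor with h | h
    · simp [h]
    · exact mul_nonneg (sub_nonneg.2 hle)
        (sub_nonneg.2 (invMean_monotoneOn (hS hμ) (hS hm) (h μ hμ)))
  have hk1 : k * (1 / k) = 1 := by field_simp
  have h1 := mul_le_mul_of_nonneg_left ht hk.le
  have h2 := mul_nonneg hk.le hcomp
  unfold divergence
  have h3 : k * ((ν + 1 / k - c) * (E.invMean c - E.invMean μ)) =
      (k * ν + 1 - k * c) * (E.invMean c - E.invMean μ) := by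
    linear_combination (E.invMean c - E.invMean μ) * hk1
  rw [h3] at h2
  linarith

lemma invMean_le_xi {k ν : ℝ} (hk : 0 < k) (hν : ν ∈ Θ) : E.invMean ν ≤ E.xi Θ k ν := by
  simpa [divergence_self] using le_xi hS hI hc hk hν hν

/-- The penalty grows with `k`; the maximizer for `k₂` serves as a competitor for `k₁`. -/
lemma xi_anti {k₁ k₂ ν : ℝ} (hk : 0 < k₁) (h : k₁ ≤ k₂) (hν : ν ∈ Θ) :
    E.xi Θ k₂ ν ≤ E.xi Θ k₁ ν := by
  have hk₂ := hk.trans_le h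
  have hm := clip_add_mem hI hc hk₂ hν
  rw [xi_eq hk₂]
  refine le_trans ?_ (le_xi hS hI hc hk hν hm)
  have := divergence_nonneg (hS hν) (invMean_mem (hS hm))
  nlinarith

/-- Take the maximizer for `ν₁`. If it lies beyond `invMean ν₂`, its penalty shrinks under `ν₂`;
otherwise the value is already at most `invMean ν₂`. -/
lemma xi_mono {k ν₁ ν₂ : ℝ} (hk : 0 < k) (h₁ : ν₁ ∈ Θ) (h₂ : ν₂ ∈ Θ) (h : ν₁ ≤ ν₂) :
    E.xi Θ k ν₁ ≤ E.xi Θ k ν₂ := by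
  have hm := clip_add_mem hI hc hk h₁
  rw [xi_eq hk]
  rcases le_total (E.invMean ν₂) (E.invMean (clip Θ (ν₁ + 1 / k))) with hle | hle
  · refine le_trans ?_ (le_xi hS hI hc hk h₂ hm)
    have := divergence_anti (hS h₁) (hS h₂) h hle
    nlinarith
  · have := divergence_nonneg (hS h₁) (invMean_mem (hS hm))
    have := invMean_le_xi hS hI hc hk h₂
    nlinarith

omit hc in
-- The witness `k` makes `θ'' + 1/k` the midpoint of `θ''` and `θ'`, where no clipping occurs.
-- Without nonemptiness the infimum would be the default value `0`.
lemma Kstar_set_nonempty {θ' θ'' : ℝ} (h' : θ' ∈ Θ) (h'' : θ'' ∈ Θ) (h : θ'' < θ') :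
    {k : ℝ | 0 < k ∧ E.xi Θ k θ'' < E.invMean θ'}.Nonempty := by
  have hd : 0 < θ' - θ'' := sub_pos.2 h
  have hk : 0 < 2 / (θ' - θ'') := by positivity
  have hm : θ'' + 1 / (2 / (θ' - θ'')) = (θ'' + θ') / 2 := by rw [one_div_div]; ring
  have hmem : (θ'' + θ') / 2 ∈ Θ := hI.out h'' h' ⟨by linarith, by linarith⟩
  refine ⟨2 / (θ' - θ''), hk, ?_⟩
  rw [xi_eq hk, hm, clip_of_mem hmem]
  have h1 := divergence_nonneg (hS h'') (invMean_mem (hS hmem))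
  have h2 := invMean_strictMonoOn (hS hmem) (hS h') (by linarith)
  nlinarith

omit hS hI hc in
lemma Kstar_set_bddBelow (θ' θ'' : ℝ) :
    BddBelow {k : ℝ | 0 < k ∧ E.xi Θ k θ'' < E.invMean θ'} := ⟨0, fun _ h => h.1.le⟩

lemma xi_lt_of_Kstar_lt {θ' θ'' k : ℝ} (h' : θ' ∈ Θ) (h'' : θ'' ∈ Θ) (h : θ'' < θ')
    (hk : E.Kstar Θ θ' θ'' < k) : E.xi Θ k θ'' < E.invMean θ' := by
  obtain ⟨k', hk', hlt⟩ := exists_lt_of_csInf_lt (Kstar_set_nonempty hS hI h' h'' h) hk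
  exact (xi_anti hS hI hc hk'.1 hlt.le h'').trans_lt hk'.2

omit hS hI hc in
lemma le_xi_of_lt_Kstar {θ' θ'' k : ℝ} (hk0 : 0 < k) (hk : k < E.Kstar Θ θ' θ'') :
    E.invMean θ' ≤ E.xi Θ k θ'' := by
  by_contra! h
  exact notMem_of_lt_csInf hk (Kstar_set_bddBelow _ _) ⟨hk0, h⟩

omit hS hI hc in
lemma Kstar_nonneg (θ' θ'' : ℝ) : 0 ≤ E.Kstar Θ θ' θ'' := Real.sInf_nonneg fun _ h => h.1.le

/-- Testing the variational formula at a mean `θ > θ'` bounds every admissible `k` away from zero.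
Positivity matters because the lower bound on `Cα` divides by `K*`. -/
lemma Kstar_pos {θ θ' θ'' : ℝ} (hθ : θ ∈ Θ) (h' : θ' ∈ Θ) (h'' : θ'' ∈ Θ) (h : θ'' < θ')
    (hlt : θ' < θ) : 0 < E.Kstar Θ θ' θ'' := by
  have hη := sub_pos.2 (invMean_strictMonoOn (hS h') (hS hθ) hlt)
  have hB := divergence_nonneg (hS h'') (invMean_mem (hS hθ))
  -- Adding one gives a positive denominator without strict positivity of the divergence.
  have hB1 : 0 < E.divergence θ'' (E.invMean θ) + 1 := by linarith
  refine lt_of_lt_of_le (div_pos hη hB1)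
    (le_csInf (Kstar_set_nonempty hS hI h' h'' h) fun k hk => ?_)
  have h1 := (le_xi hS hI hc hk.1 h'' hθ).trans_lt hk.2
  rw [div_le_iff₀ hB1]
  nlinarith [hk.1]

lemma Kstar_le_Kstar {θ₁' θ₂' θ₁'' θ₂'' : ℝ} (h₁' : θ₁' ∈ Θ) (h₂' : θ₂' ∈ Θ) (h₁'' : θ₁'' ∈ Θ)
    (h₂'' : θ₂'' ∈ Θ) (h' : θ₂' ≤ θ₁') (h'' : θ₁'' ≤ θ₂'') (h : θ₂'' < θ₂') :
    E.Kstar Θ θ₁' θ₁'' ≤ E.Kstar Θ θ₂' θ₂'' :=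
  csInf_le_csInf (Kstar_set_bddBelow _ _) (Kstar_set_nonempty hS hI h₂' h₂'' h) fun _ hk =>
    ⟨hk.1, (xi_mono hS hI hc hk.1 h₁'' h₂'' h'').trans_lt
      (hk.2.trans_le (invMean_monotoneOn (hS h₂') (hS h₁') h'))⟩

end

end ExpFamily

end RBMLE

namespace RBMLE

open scoped ENNReal

/-! ### Choice of the Chernoff parameter. -/

section Tail

/-- A Chernoff parameter for which `n` samples with deviation `x ≥ y` per sample have an exponent of
at least `2 log τ`, provided that `n` is at least a suitable multiple of `log τ`. -/
lemma exists_chernoff_parameter {ρ κ y τ : ℝ} (hκ : 0 ≤ κ) (hy : 0 < y) (hτ : 1 ≤ τ) :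
    ∃ l : ℝ, 0 < l ∧ κ * l < 1 ∧ ∀ n x : ℝ, y ≤ x → 1 ≤ n →
      8 * (κ * y + ρ ^ 2) / y ^ 2 * Real.log τ ≤ n →
      2 * Real.log τ ≤ n * (l * x - ρ ^ 2 * l ^ 2 / 2) := by
  have hlog : 0 ≤ Real.log τ := Real.log_nonneg hτ
  have hκy : 0 ≤ κ * y := mul_nonneg hκ hy.le
  rcases (add_nonneg hκy (sq_nonneg ρ)).eq_or_lt with h0 | hd
  · have hρ : ρ ^ 2 = 0 := by linarith [sq_nonneg ρ]
    have hκ0 : κ = 0 := by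
      have : κ * y = 0 := by linarith
      exact (mul_eq_zero.1 this).resolve_right hy.ne'
    -- For `ρ = κ = 0` every `l` is allowed, and `1 ≤ n` must supply the exponent; the `+ 1` keeps
    -- `l` positive at `τ = 1`.
    refine ⟨2 * Real.log τ / y + 1, by positivity, by simp [hκ0], fun n x hx hn _ => ?_⟩
    rw [hρ, zero_mul, zero_div, sub_zero]
    have h1 : 2 * Real.log τ ≤ (2 * Real.log τ / y + 1) * y := by
      rw [add_mul, div_mul_cancel₀ _ hy.ne']; linarith
    have hl : 0 < 2 * Real.log τ / y + 1 := by positivity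
    have h2 := mul_le_mul_of_nonneg_left hx hl.le
    have h3 : 0 ≤ (2 * Real.log τ / y + 1) * x := by linarith
    nlinarith
  · set d := κ * y + ρ ^ 2
    have hl : 0 < y / (2 * d) := by positivity
    refine ⟨y / (2 * d), hl, ?_, fun n x hx hn h => ?_⟩
    · rw [← mul_div_assoc, div_lt_one (by positivity)]
      linarith [sq_nonneg ρ]
    · have h1 : ρ ^ 2 * (y / (2 * d)) ≤ x := by
        rw [← mul_div_assoc, div_le_iff₀ (by positivity)]
        nlinarith [mul_nonneg hκy hy.le, sq_nonneg ρ]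
      have h2 : y / (2 * d) * y / 2 ≤ y / (2 * d) * x - ρ ^ 2 * (y / (2 * d)) ^ 2 / 2 := by
        nlinarith
      have h3 : 8 * d / y ^ 2 * Real.log τ * (y / (2 * d) * y / 2) = 2 * Real.log τ := by
        field_simp
        ring
      have h4 : 0 ≤ y / (2 * d) * y / 2 := by positivity
      calc 2 * Real.log τ = _ := h3.symm
        _ ≤ n * (y / (2 * d) * y / 2) := mul_le_mul_of_nonneg_right h h4
        _ ≤ _ := mul_le_mul_of_nonneg_left h2 (by linarith)

end Tail

/-! ### Pull counts, rewards along a path, and concentration. -/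

section Bandit

variable {N : ℕ} {Ω : Type*}

section Path

variable (arm : ℕ → Ω → Fin N) (X : ℕ → Ω → ℝ) (i : Fin N) (t : ℕ) (ω : Ω)

@[simp] lemma pulls_zero : pulls arm i 0 ω = 0 := by simp [pulls]

@[simp] lemma totalReward_zero : totalReward arm X i 0 ω = 0 := by simp [totalReward]

lemma pulls_succ : pulls arm i (t + 1) ω = pulls arm i t ω + if arm (t + 1) ω = i then 1 else 0 := by
  unfold pulls
  rw [← Finset.insert_Icc_right_eq_Icc_add_one (by omega), Finset.filter_insert]
  split_ifs <;> simp

lemma totalReward_succ : totalReward arm X i (t + 1) ω =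
    totalReward arm X i t ω + if arm (t + 1) ω = i then X (t + 1) ω else 0 := by
  unfold totalReward
  rw [← Finset.insert_Icc_right_eq_Icc_add_one (by omega), Finset.filter_insert]
  split_ifs
  · rw [Finset.sum_insert (by simp), add_comm]
  · simp

lemma ite_arm_eq_indicator (f : Ω → ℝ) (i : Fin N) :
    (fun ω => if arm t ω = i then f ω else 0) = Set.indicator {ω | arm t ω = i} f := by
  ext ω
  simp [Set.indicator]

/-- The number of pulls is at most `q + 1` plus the number of pulls made after the arm has been
pulled more than `q` times. -/
lemma pulls_le {q : ℝ} (hq : 0 ≤ q) (T : ℕ) : (pulls arm i T ω : ℝ) ≤ q + 1 +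
    ∑ t ∈ Finset.range T, if arm (t + 1) ω = i ∧ q < pulls arm i t ω then (1 : ℝ) else 0 := by
  induction T with
  | zero => simp; linarith
  | succ T ih =>
    rw [pulls_succ, Finset.sum_range_succ]
    by_cases h : arm (T + 1) ω = i
    · by_cases hlt : q < pulls arm i T ω
      · simp only [h, hlt, and_self, if_true]; push_cast; linarith
      · have : 0 ≤ ∑ t ∈ Finset.range T,
            if arm (t + 1) ω = i ∧ q < pulls arm i t ω then (1 : ℝ) else 0 :=
          Finset.sum_nonneg fun _ _ => by split_ifs <;> norm_num
        simp only [h, hlt, and_false, if_true, if_false]; push_cast; linarith [not_lt.1 hlt]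
    · simp only [h, false_and, if_false]; push_cast; linarith

lemma sum_totalReward (T : ℕ) : ∑ a, totalReward arm X a T ω = ∑ t ∈ Finset.Icc 1 T, X t ω :=
  Finset.sum_fiberwise _ _ _

lemma sum_pulls (T : ℕ) : ∑ a, (pulls arm a T ω : ℝ) = T := by
  have := sum_totalReward arm (fun _ _ => 1) ω T
  simpa [totalReward, pulls] using this

variable {arm X i t ω}

lemma empMean_mem {Θ : Set ℝ} (hΘ : Convex ℝ Θ) (hX : ∀ s, X (s + 1) ω ∈ Θ)
    (h : pulls arm i t ω ≠ 0) : empMean arm X i t ω ∈ Θ := by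
  have hc : (pulls arm i t ω : ℝ) ≠ 0 := Nat.cast_ne_zero.2 h
  have : empMean arm X i t ω = ∑ s ∈ (Finset.Icc 1 t).filter (fun s => arm s ω = i),
      (pulls arm i t ω : ℝ)⁻¹ • X s ω := by
    rw [empMean, totalReward, ← Finset.smul_sum, smul_eq_mul, div_eq_inv_mul]
  rw [this]
  refine hΘ.sum_mem (fun _ _ => by positivity) ?_ fun s hs => ?_
  · rw [Finset.sum_const, nsmul_eq_mul]
    exact mul_inv_cancel₀ hc
  · obtain ⟨s, rfl⟩ := Nat.exists_eq_add_of_le' (Finset.mem_Icc.1 (Finset.mem_filter.1 hs).1).1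
    exact hX s

end Path

/-- After round `t`, arm `a` has been pulled at least `c log (t + 1)` times, and its total reward
deviates from the mean `θ` per pull by at least `x` per pull, in the direction `σ`. -/
def deviationEvent (arm : ℕ → Ω → Fin N) (X : ℕ → Ω → ℝ) (θ c x σ : ℝ) (a : Fin N) (t : ℕ) :
    Set Ω :=
  {ω | 1 ≤ (pulls arm a t ω : ℝ) ∧ c * Real.log ((t + 1 : ℕ) : ℝ) ≤ pulls arm a t ω ∧
    pulls arm a t ω * x ≤ σ * (totalReward arm X a t ω - pulls arm a t ω * θ)}

namespace IsBandit

variable [mΩ : MeasurableSpace Ω] {P : Measure Ω} {ℱ : Filtration ℕ mΩ}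
  {D : Fin N → Measure ℝ} {arm : ℕ → Ω → Fin N} {X : ℕ → Ω → ℝ}

section

variable (hb : IsBandit P ℱ D arm X)

include hb

lemma measurableSet_arm' (t : ℕ) (i : Fin N) : MeasurableSet[ℱ t] {ω | arm (t + 1) ω = i} :=
  hb.measurable_arm t (measurableSet_singleton i)

lemma measurableSet_arm (t : ℕ) (i : Fin N) : MeasurableSet {ω | arm (t + 1) ω = i} :=
  ℱ.le t _ (hb.measurableSet_arm' t i)

lemma measurable_X (t : ℕ) : Measurable (X (t + 1)) := (hb.measurable_reward t).mono (ℱ.le _) le_rfl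

lemma measurable_pulls (i : Fin N) (t : ℕ) :
    Measurable[ℱ t] (fun ω => (pulls arm i t ω : ℝ)) := by
  induction t with
  | zero => simp
  | succ t ih =>
    simp only [pulls_succ, Nat.cast_add, Nat.cast_ite, Nat.cast_one, Nat.cast_zero]
    refine Measurable.add (ih.mono (ℱ.mono t.le_succ) le_rfl) ?_
    exact Measurable.ite (ℱ.mono t.le_succ _ (hb.measurableSet_arm' t i)) measurable_const
      measurable_const

lemma measurable_totalReward (i : Fin N) (t : ℕ) : Measurable[ℱ t] (totalReward arm X i t) := by
  induction t with
  | zero =>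
    have : totalReward arm X i 0 = fun _ => 0 := by ext; simp
    rw [this]; exact measurable_const
  | succ t ih =>
    have : totalReward arm X i (t + 1) = fun ω => totalReward arm X i t ω +
      if arm (t + 1) ω = i then X (t + 1) ω else 0 := by ext; rw [totalReward_succ]
    rw [this]
    refine Measurable.add (ih.mono (ℱ.mono t.le_succ) le_rfl) ?_
    exact Measurable.ite (ℱ.mono t.le_succ _ (hb.measurableSet_arm' t i)) (hb.measurable_reward t)
      measurable_const

lemma measurableSet_deviationEvent (θ c x σ : ℝ) (a : Fin N) (t : ℕ) :
    MeasurableSet (deviationEvent arm X θ c x σ a t) := by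
  have h1 := (hb.measurable_totalReward a t).mono (ℱ.le t) le_rfl
  have h2 := (hb.measurable_pulls a t).mono (ℱ.le t) le_rfl
  exact (measurableSet_le measurable_const h2).inter ((measurableSet_le measurable_const h2).inter
    (measurableSet_le (h2.mul_const _) ((h1.sub (h2.mul_const _)).const_mul _)))

/-- On any event of the past where arm `i` is chosen, the reward has law `D i`. -/
lemma map_restrict {t : ℕ} {i : Fin N} {H : Set Ω} (hH : MeasurableSet[ℱ t] H) :
    (P.restrict (H ∩ {ω | arm (t + 1) ω = i})).map (X (t + 1)) =
      P (H ∩ {ω | arm (t + 1) ω = i}) • D i := by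
  ext B hB
  rw [Measure.map_apply (hb.measurable_X t) hB, Measure.restrict_apply (hb.measurable_X t hB),
    Measure.smul_apply, smul_eq_mul, ← hb.reward_law t i H B hH hB]
  congr 1
  ext ω
  simp only [Set.mem_inter_iff, Set.mem_preimage, Set.mem_ofPred_eq]
  tauto

lemma map_restrict_arm (t : ℕ) (i : Fin N) :
    (P.restrict {ω | arm (t + 1) ω = i}).map (X (t + 1)) = P {ω | arm (t + 1) ω = i} • D i := by
  simpa using hb.map_restrict (t := t) (i := i) MeasurableSet.univ

/-- Where arm `i` is chosen, the reward is independent of the past and has law `D i`. -/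
lemma setLIntegral_mul {t : ℕ} {i : Fin N} {f : Ω → ℝ≥0∞} {g : ℝ → ℝ≥0∞}
    (hf : Measurable[ℱ t] f) (hg : Measurable g) :
    ∫⁻ ω in {ω | arm (t + 1) ω = i}, f ω * g (X (t + 1) ω) ∂P =
      (∫⁻ ω in {ω | arm (t + 1) ω = i}, f ω ∂P) * ∫⁻ x, g x ∂(D i) := by
  have hgX : Measurable fun ω => g (X (t + 1) ω) := hg.comp (hb.measurable_X t)
  have hf' : Measurable f := hf.mono (ℱ.le t) le_rfl
  set ν := P.restrict {ω | arm (t + 1) ω = i} with hν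
  -- On the past, weighting by `g (X (t + 1))` only rescales the measure; this is `reward_law`
  -- tested on past events `H`.
  have key : (ν.withDensity fun ω => g (X (t + 1) ω)).trim (ℱ.le t) =
      ((∫⁻ x, g x ∂(D i)) • ν).trim (ℱ.le t) := by
    refine @Measure.ext _ (ℱ t) _ _ fun H hH => ?_
    have hH' := ℱ.le t H hH
    rw [trim_measurableSet_eq _ hH, trim_measurableSet_eq _ hH, withDensity_apply _ hH',
      hν, Measure.restrict_restrict hH', ← lintegral_map hg (hb.measurable_X t),
      hb.map_restrict hH, lintegral_smul_measure, Measure.smul_apply, Measure.restrict_apply hH',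
      smul_eq_mul, smul_eq_mul, mul_comm]
  calc ∫⁻ ω, f ω * g (X (t + 1) ω) ∂ν
      = ∫⁻ ω, f ω ∂(ν.withDensity fun ω => g (X (t + 1) ω)) := by
        rw [lintegral_withDensity_eq_lintegral_mul _ hgX hf']
        simp [mul_comm]
    _ = _ := by
        rw [← lintegral_trim (ℱ.le t) hf, key, lintegral_trim (ℱ.le t) hf, lintegral_smul_measure,
          smul_eq_mul, mul_comm]

lemma ae_reward_mem {Θ : Set ℝ} (hD : ∀ i, ∀ᵐ x ∂(D i), x ∈ Θ) :
    ∀ᵐ ω ∂P, ∀ t, X (t + 1) ω ∈ Θ := by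
  refine ae_all_iff.2 fun t => ?_
  have h : ∀ i, ∀ᵐ ω ∂P, arm (t + 1) ω = i → X (t + 1) ω ∈ Θ := fun i => by
    refine (ae_restrict_iff' (hb.measurableSet_arm t i)).1 ?_
    refine ae_of_ae_map (hb.measurable_X t).aemeasurable ?_
    rw [hb.map_restrict_arm]
    exact Measure.ae_smul_measure (hD i) _
  filter_upwards [ae_all_iff.2 h] with ω hω using hω _ rfl

variable [IsProbabilityMeasure P]

/-- The exponential process of the reward of an arm has expectation at most one. -/
lemma lintegral_exp_le {ρ κ l : ℝ} (a : Fin N) (hsub : IsSubExponential (D a) ρ κ)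
    (hl : κ * |l| < 1) (t : ℕ) :
    ∫⁻ ω, ENNReal.ofReal (Real.exp (l * (totalReward arm X a t ω -
      pulls arm a t ω * armMean D a) - pulls arm a t ω * (ρ ^ 2 * l ^ 2 / 2))) ∂P ≤ 1 := by
  set W : ℕ → Ω → ℝ≥0∞ := fun t ω => ENNReal.ofReal (Real.exp (l * (totalReward arm X a t ω -
      pulls arm a t ω * armMean D a) - pulls arm a t ω * (ρ ^ 2 * l ^ 2 / 2))) with hW
  have hWm : ∀ t, Measurable[ℱ t] (W t) := fun t => by
    refine ENNReal.measurable_ofReal.comp (Real.measurable_exp.comp ?_)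
    exact ((((hb.measurable_totalReward a t).sub
      ((hb.measurable_pulls a t).mul_const _)).const_mul l).sub
        ((hb.measurable_pulls a t).mul_const _))
  set g : ℝ → ℝ≥0∞ := fun x =>
    ENNReal.ofReal (Real.exp (l * (x - armMean D a) - ρ ^ 2 * l ^ 2 / 2)) with hgdef
  have hgm : Measurable g := by rw [hgdef]; fun_prop
  have hg : ∫⁻ x, g x ∂(D a) ≤ 1 := by
    obtain ⟨hi, hle⟩ := hsub.2 l hl
    have : ∀ x, Real.exp (l * (x - armMean D a) - ρ ^ 2 * l ^ 2 / 2) =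
        Real.exp (l * (x - ∫ y, y ∂(D a))) * Real.exp (-(ρ ^ 2 * l ^ 2 / 2)) := fun x => by
      rw [← Real.exp_add, armMean, sub_eq_add_neg]
    simp only [hgdef, this]
    rw [← ofReal_integral_eq_lintegral_ofReal (hi.mul_const _)
      (Eventually.of_forall fun x => by positivity), integral_mul_const, ENNReal.ofReal_le_one,
      Real.exp_neg, mul_inv_le_iff₀ (Real.exp_pos _), one_mul]
    exact hle
  change ∫⁻ ω, W t ω ∂P ≤ 1
  induction t with
  | zero => simp [hW]
  | succ t ih =>
    have hA := hb.measurableSet_arm t a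
    refine le_trans ?_ ih
    rw [← lintegral_add_compl _ hA, ← lintegral_add_compl (W t) hA]
    -- Where `a` is pulled the process gains an independent factor of mean at most one; elsewhere it
    -- does not change.
    refine add_le_add ?_ ?_
    · have : ∫⁻ ω in {ω | arm (t + 1) ω = a}, W (t + 1) ω ∂P =
          ∫⁻ ω in {ω | arm (t + 1) ω = a}, W t ω * g (X (t + 1) ω) ∂P := by
        refine setLIntegral_congr_fun hA fun ω hω => ?_
        simp only [Set.mem_ofPred_eq] at hω
        simp only [hW, hgdef]
        rw [← ENNReal.ofReal_mul (Real.exp_pos _).le, ← Real.exp_add, totalReward_succ, pulls_succ,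
          if_pos hω, if_pos hω]
        congr 2
        push_cast
        ring
      rw [this, hb.setLIntegral_mul (hWm t) hgm]
      exact mul_le_of_le_one_right' hg
    · refine le_of_eq (setLIntegral_congr_fun hA.compl fun ω hω => ?_)
      have hω' : ¬ arm (t + 1) ω = a := hω
      simp only [hW, totalReward_succ, pulls_succ, if_neg hω', add_zero]

/-- Deviations of the total reward of an arm that was pulled sufficiently often are unlikely. -/
lemma measureReal_deviationEvent_le {ρ κ x y σ : ℝ} (a : Fin N)
    (hsub : IsSubExponential (D a) ρ κ) (hκ : 0 ≤ κ) (hσ : |σ| = 1) (hy : 0 < y) (hyx : y ≤ x)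
    (t : ℕ) :
    P.real (deviationEvent arm X (armMean D a) (8 * (κ * y + ρ ^ 2) / y ^ 2) x σ a t) ≤
      1 / ((t + 1 : ℕ) : ℝ) ^ 2 := by
  have hτ : (1 : ℝ) ≤ ((t + 1 : ℕ) : ℝ) := by simp
  have hτ0 : (0 : ℝ) < ((t + 1 : ℕ) : ℝ) := by linarith
  obtain ⟨l, hl, hκl, hexp⟩ := exists_chernoff_parameter (ρ := ρ) hκ hy hτ
  have hσ2 : σ ^ 2 = 1 := by rw [← sq_abs, hσ, one_pow]
  have hWl := hb.lintegral_exp_le (l := σ * l) a hsub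
    (by rwa [abs_mul, hσ, one_mul, abs_of_pos hl]) t
  set W : Ω → ℝ≥0∞ := fun ω => ENNReal.ofReal (Real.exp (σ * l * (totalReward arm X a t ω -
      pulls arm a t ω * armMean D a) - pulls arm a t ω * (ρ ^ 2 * (σ * l) ^ 2 / 2))) with hW
  have hWm : Measurable W := by
    refine ENNReal.measurable_ofReal.comp (Real.measurable_exp.comp ?_)
    have h1 := (hb.measurable_totalReward a t).mono (ℱ.le t) le_rfl
    have h2 := (hb.measurable_pulls a t).mono (ℱ.le t) le_rfl
    exact (((h1.sub (h2.mul_const _)).const_mul _).sub (h2.mul_const _))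
  have hpos : (0 : ℝ) < ((t + 1 : ℕ) : ℝ) ^ 2 := by positivity
  have hsubset : deviationEvent arm X (armMean D a) (8 * (κ * y + ρ ^ 2) / y ^ 2) x σ a t ⊆
      {ω | ENNReal.ofReal (((t + 1 : ℕ) : ℝ) ^ 2) ≤ W ω} := by
    -- Since `l` does not depend on the random number of pulls, the event forces `W ≥ (t + 1)²`.
    rintro ω ⟨h1, h2, h3⟩
    refine ENNReal.ofReal_le_ofReal ?_
    rw [← Real.exp_log hpos, Real.log_pow]
    refine Real.exp_le_exp.2 ?_
    have := hexp _ x hyx h1 h2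
    rw [mul_pow, hσ2, one_mul]
    have h4 := mul_le_mul_of_nonneg_left h3 hl.le
    push_cast at this ⊢
    linarith
  refine ENNReal.toReal_le_of_le_ofReal (by positivity) ((measure_mono hsubset).trans ?_)
  refine (meas_ge_le_lintegral_div hWm.aemeasurable (ENNReal.ofReal_pos.2 hpos).ne'
    ENNReal.ofReal_ne_top).trans ?_
  rw [ENNReal.ofReal_div_of_pos hpos, ENNReal.ofReal_one]
  exact ENNReal.div_le_div_right hWl _

lemma integrableOn_reward (hD : ∀ i, Integrable (fun x => x) (D i)) (t : ℕ) (i : Fin N) :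
    IntegrableOn (X (t + 1)) {ω | arm (t + 1) ω = i} P := by
  have h := (hD i).smul_measure (measure_ne_top P {ω | arm (t + 1) ω = i})
  rw [← hb.map_restrict_arm] at h
  exact h.comp_measurable (hb.measurable_X t)

omit [IsProbabilityMeasure P] in
lemma setIntegral_reward (t : ℕ) (i : Fin N) :
    ∫ ω in {ω | arm (t + 1) ω = i}, X (t + 1) ω ∂P =
      P.real {ω | arm (t + 1) ω = i} * armMean D i := by
  have h := integral_map (μ := P.restrict {ω | arm (t + 1) ω = i})
    (hb.measurable_X t).aemeasurable (f := fun x : ℝ => x) measurable_id.aestronglyMeasurable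
  rw [← h, hb.map_restrict_arm, integral_smul_measure]
  rfl

lemma integrable_indicator_reward (hD : ∀ i, Integrable (fun x => x) (D i)) (t : ℕ) (i : Fin N) :
    Integrable (fun ω => if arm (t + 1) ω = i then X (t + 1) ω else 0) P := by
  rw [ite_arm_eq_indicator]
  exact (hb.integrableOn_reward hD t i).integrable_indicator (hb.measurableSet_arm t i)

omit [IsProbabilityMeasure P] in
lemma integral_indicator_reward (t : ℕ) (i : Fin N) :
    ∫ ω, (if arm (t + 1) ω = i then X (t + 1) ω else 0) ∂P =
      P.real {ω | arm (t + 1) ω = i} * armMean D i := by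
  rw [← hb.setIntegral_reward, ← integral_indicator (hb.measurableSet_arm t i), ite_arm_eq_indicator]

lemma integrable_indicator_arm (t : ℕ) (i : Fin N) :
    Integrable (fun ω => if arm (t + 1) ω = i then (1 : ℝ) else 0) P := by
  rw [ite_arm_eq_indicator]
  exact (integrable_const (1 : ℝ)).indicator (hb.measurableSet_arm t i)

omit [IsProbabilityMeasure P] in
lemma integral_indicator_arm (t : ℕ) (i : Fin N) :
    ∫ ω, (if arm (t + 1) ω = i then (1 : ℝ) else 0) ∂P = P.real {ω | arm (t + 1) ω = i} := by
  rw [ite_arm_eq_indicator]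
  exact integral_indicator_one (hb.measurableSet_arm t i)

lemma integrable_pulls (i : Fin N) (t : ℕ) : Integrable (fun ω => (pulls arm i t ω : ℝ)) P := by
  induction t with
  | zero => simp
  | succ t ih =>
    simp only [pulls_succ, Nat.cast_add, Nat.cast_ite, Nat.cast_one, Nat.cast_zero]
    exact ih.add (hb.integrable_indicator_arm t i)

lemma integrable_totalReward (hD : ∀ i, Integrable (fun x => x) (D i)) (i : Fin N) (t : ℕ) :
    Integrable (fun ω => totalReward arm X i t ω) P := by
  induction t with
  | zero => simp
  | succ t ih =>
    simp only [totalReward_succ]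
    exact ih.add (hb.integrable_indicator_reward hD t i)

/-- Wald's identity for the reward collected from one arm. -/
lemma integral_totalReward (hD : ∀ i, Integrable (fun x => x) (D i)) (i : Fin N) (t : ℕ) :
    ∫ ω, totalReward arm X i t ω ∂P = (∫ ω, (pulls arm i t ω : ℝ) ∂P) * armMean D i := by
  induction t with
  | zero => simp
  | succ t ih =>
    simp only [totalReward_succ, pulls_succ, Nat.cast_add, Nat.cast_ite, Nat.cast_one,
      Nat.cast_zero]
    rw [integral_add (hb.integrable_totalReward hD i t) (hb.integrable_indicator_reward hD t i),
      integral_add (hb.integrable_pulls i t) (hb.integrable_indicator_arm t i), ih,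
      hb.integral_indicator_reward, hb.integral_indicator_arm, add_mul]

lemma regret_eq (hD : ∀ i, Integrable (fun x => x) (D i)) (best : Fin N) (T : ℕ) :
    regret P D X best T = ∑ a, (armMean D best - armMean D a) *
      ∫ ω, (pulls arm a T ω : ℝ) ∂P := by
  have h1 : ∫ ω, ∑ t ∈ Finset.Icc 1 T, X t ω ∂P =
      ∑ a, (∫ ω, (pulls arm a T ω : ℝ) ∂P) * armMean D a := by
    simp only [← sum_totalReward arm X _ T]
    rw [integral_finsetSum _ fun a _ => hb.integrable_totalReward hD a T]
    exact Finset.sum_congr rfl fun a _ => hb.integral_totalReward hD a T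
  have h2 : (T : ℝ) = ∑ a, ∫ ω, (pulls arm a T ω : ℝ) ∂P := by
    rw [← integral_finsetSum _ fun a _ => hb.integrable_pulls a T]
    simp only [sum_pulls arm _ T]
    simp
  rw [regret, h1]
  nth_rewrite 1 [h2]
  rw [Finset.sum_mul, ← Finset.sum_sub_distrib]
  exact Finset.sum_congr rfl fun a _ => by ring

end

end IsBandit

end Bandit

end RBMLE

namespace RBMLE

/-! ### Suboptimal pulls force deviations; expected pull counts. -/

section Regret

variable {N : ℕ} {Ω : Type*}

/-- If RBMLE pulls a suboptimal arm that has already been pulled sufficiently often, then the total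
reward of this arm or that of the best arm deviates from its expectation. -/
lemma FollowsRBMLE.mem_deviationEvent {E : ExpFamily} {Θ : Set ℝ} (hS : Θ ⊆ E.meanSpace)
    (hI : Θ.OrdConnected) (hc : IsClosed Θ) {θlow : ℝ} (hlow : IsLeast Θ θlow)
    {arm : ℕ → Ω → Fin N} {X : ℕ → Ω → ℝ} {ω : Ω} {Cα : ℝ} (hCα : 0 < Cα)
    (hpol : FollowsRBMLE E Θ (fun t => Cα * Real.log t) arm X ω) (hX : ∀ s, X (s + 1) ω ∈ Θ)
    {θ₁ θa x y c : ℝ} (hθ₁ : θ₁ ∈ Θ) (hθa : θa ∈ Θ) (hy : 0 < y) (hyx : y ≤ x)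
    (hgap : θa + x < θ₁ - x) (hcK : c ≤ Cα * E.Kstar Θ (θ₁ - y) θlow) {best a : Fin N} {t : ℕ}
    (ha : arm (t + 1) ω = a)
    (hN : Cα * E.Kstar Θ (θ₁ - x) (θa + x) * Real.log ((t + 1 : ℕ) : ℝ) < pulls arm a t ω) :
    ω ∈ deviationEvent arm X θa c x 1 a t ∪ deviationEvent arm X θ₁ c x (-1) best t := by
  have hτ : (1 : ℝ) ≤ ((t + 1 : ℕ) : ℝ) := by simp
  have hlog : 0 ≤ Real.log ((t + 1 : ℕ) : ℝ) := Real.log_nonneg hτ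
  have hmemx : θ₁ - x ∈ Θ := hI.out hθa hθ₁ ⟨by linarith, by linarith⟩
  have hmemy : θ₁ - y ∈ Θ := hI.out hmemx hθ₁ ⟨by linarith, by linarith⟩
  have hmema : θa + x ∈ Θ := hI.out hθa hθ₁ ⟨by linarith, by linarith⟩
  -- Hence the pull threshold of `a` exceeds `c log (t + 1)`, as its deviation event requires.
  have hK : E.Kstar Θ (θ₁ - y) θlow ≤ E.Kstar Θ (θ₁ - x) (θa + x) :=
    ExpFamily.Kstar_le_Kstar hS hI hc hmemy hmemx hlow.1 hmema (by linarith) (hlow.2 hmema) hgap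
  have hNa : (0 : ℝ) < pulls arm a t ω :=
    (mul_nonneg (mul_nonneg hCα.le (ExpFamily.Kstar_nonneg _ _)) hlog).trans_lt hN
  have hall : ∀ i, pulls arm i t ω ≠ 0 := fun i hi => by
    have := (hpol t).1 ⟨i, hi⟩
    rw [ha] at this
    simp [this] at hNa
  have hone : ∀ i, 1 ≤ (pulls arm i t ω : ℝ) := fun i => by
    exact_mod_cast Nat.one_le_iff_ne_zero.2 (hall i)
  have hpos : ∀ i, 0 < (pulls arm i t ω : ℝ) := fun i => zero_lt_one.trans_le (hone i)
  -- Excludes `log 1 = 0`, so that the bias is positive and can be divided out.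
  have ht : t ≠ 0 := by
    rintro rfl
    simp at hNa
  have hlogpos : 0 < Real.log ((t + 1 : ℕ) : ℝ) := Real.log_pos (by
    have : (0 : ℝ) < t := by exact_mod_cast Nat.pos_of_ne_zero ht
    push_cast
    linarith)
  have hα : 0 < Cα * Real.log ((t + 1 : ℕ) : ℝ) := mul_pos hCα hlogpos
  have hp : ∀ i, empMean arm X i t ω ∈ Θ := fun i => empMean_mem hI.convex hX (hall i)
  have hidx := (hpol t).2 hall best
  rw [ha] at hidx
  simp only at hidx
  rw [ExpFamily.index_eq_mul_xi (hpos _).ne' hα.ne', ExpFamily.index_eq_mul_xi (hpos _).ne' hα.ne']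
    at hidx
  have hxi := le_of_mul_le_mul_left hidx hα
  set α := Cα * Real.log ((t + 1 : ℕ) : ℝ)
  have hka : 0 < (pulls arm a t ω : ℝ) / α := div_pos (hpos _) hα
  have hkb : 0 < (pulls arm best t ω : ℝ) / α := div_pos (hpos _) hα
  have hcα : c * Real.log ((t + 1 : ℕ) : ℝ) ≤ E.Kstar Θ (θ₁ - y) θlow * α := by
    have := mul_le_mul_of_nonneg_right hcK hlog
    simp only [α]; linarith
  have hNa' : E.Kstar Θ (θ₁ - x) (θa + x) * α < pulls arm a t ω := by simp only [α]; linarith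
  by_contra hU
  rw [Set.mem_union, not_or] at hU
  have hpa : empMean arm X a t ω ≤ θa + x := by
    by_contra! h
    refine hU.1 ⟨hone a, ?_, ?_⟩
    · have := mul_le_mul_of_nonneg_right hK hα.le
      linarith
    · rw [empMean, lt_div_iff₀ (hpos a)] at h
      linarith
  have hupper : E.xi Θ (pulls arm a t ω / α) (empMean arm X a t ω) < E.invMean (θ₁ - x) :=
    (ExpFamily.xi_mono hS hI hc hka (hp a) hmema hpa).trans_lt
      (ExpFamily.xi_lt_of_Kstar_lt hS hI hc hmemx hmema hgap ((lt_div_iff₀ hα).2 hNa'))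
  refine absurd hxi (not_le.2 (hupper.trans_le ?_))
  by_cases hNb : c * Real.log ((t + 1 : ℕ) : ℝ) ≤ pulls arm best t ω
  · have hpb : θ₁ - x ≤ empMean arm X best t ω := by
      by_contra! h
      refine hU.2 ⟨hone best, hNb, ?_⟩
      rw [empMean, div_lt_iff₀ (hpos best)] at h
      linarith
    exact (ExpFamily.invMean_monotoneOn (hS hmemx) (hS (hp best)) hpb).trans
      (ExpFamily.invMean_le_xi hS hI hc hkb (hp best))
  -- Undersampled best arm: its empirical mean is only known to be at least `θlow`, and `k` below
  -- `K*(θ₁ - y, θlow)` suffices.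
  · refine (ExpFamily.invMean_monotoneOn (hS hmemx) (hS hmemy) (by linarith)).trans
      ((ExpFamily.le_xi_of_lt_Kstar hkb ((div_lt_iff₀ hα).2 ?_)).trans
        (ExpFamily.xi_mono hS hI hc hkb hlow.1 (hp best) (hlow.2 (hp best))))
    linarith [not_le.1 hNb]

lemma sum_range_one_div_sq_le (T : ℕ) :
    ∑ t ∈ Finset.range T, 1 / ((t + 1 : ℕ) : ℝ) ^ 2 ≤ Real.pi ^ 2 / 6 := by
  have h := hasSum_zeta_two
  -- The zeta series starts at index `0` with `1 / 0 = 0`, hence the range `T + 1`.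
  have := h.summable.sum_le_tsum (Finset.range (T + 1)) (fun _ _ => by positivity)
  rw [h.tsum_eq, Finset.sum_range_succ'] at this
  simpa using this

variable [mΩ : MeasurableSpace Ω] {P : Measure Ω} [IsProbabilityMeasure P] {ℱ : Filtration ℕ mΩ}
  {D : Fin N → Measure ℝ} {arm : ℕ → Ω → Fin N} {X : ℕ → Ω → ℝ}

/-- The expected number of pulls of a suboptimal arm. -/
lemma IsBandit.integral_pulls_le (hb : IsBandit P ℱ D arm X)
    {E : ExpFamily} {Θ : Set ℝ} (hS : Θ ⊆ E.meanSpace)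
    (hI : Θ.OrdConnected) (hc : IsClosed Θ) {θlow : ℝ} (hlow : IsLeast Θ θlow)
    (hD_mem : ∀ i, ∀ᵐ x ∂(D i), x ∈ Θ) {best a : Fin N} (hθ₁ : armMean D best ∈ Θ)
    (hθa : armMean D a ∈ Θ) {ρ κ : ℝ} (hκ : 0 ≤ κ) (hsub : ∀ i, IsSubExponential (D i) ρ κ)
    {Δ ε : ℝ} (hΔ : 0 < Δ) (hΔa : Δ ≤ armMean D best - armMean D a) (hε : 0 < ε) (hε1 : ε < 1)
    {Cα : ℝ} (hCα_pos : 0 < Cα)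
    (hCα : 16 * (κ * ε * Δ + 2 * ρ ^ 2) /
      ((ε * Δ) ^ 2 * E.Kstar Θ (armMean D best - ε * Δ / 2) θlow) ≤ Cα)
    (hpol : ∀ᵐ ω ∂P, FollowsRBMLE E Θ (fun t => Cα * Real.log t) arm X ω) (T : ℕ) :
    ∫ ω, (pulls arm a T ω : ℝ) ∂P ≤
      Qtilde E Θ ρ κ ε Cα (armMean D best) Δ (armMean D a) T + Real.pi ^ 2 / 3 := by
  set θ₁ := armMean D best
  set θa := armMean D a
  set y := ε * Δ / 2 with hydef
  set x := ε / 2 * (θ₁ - θa) with hxdef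
  have hy : 0 < y := by positivity
  have hyx : y ≤ x := by
    have := mul_le_mul_of_nonneg_left hΔa hε.le
    rw [hydef, hxdef]; linarith
  have hgap : θa + x < θ₁ - x := by
    have := mul_lt_mul_of_pos_right hε1 (hΔ.trans_le hΔa)
    rw [hxdef]; linarith
  have hmemy : θ₁ - y ∈ Θ := hI.out hθa hθ₁ ⟨by linarith, by linarith⟩
  have hKpos : 0 < E.Kstar Θ (θ₁ - y) θlow :=
    ExpFamily.Kstar_pos hS hI hc hθ₁ hmemy hlow.1 (by linarith [hlow.2 hθa]) (by linarith)
  set c := 8 * (κ * y + ρ ^ 2) / y ^ 2 with hcdef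
  -- With `y = εΔ/2`, `c` equals `16 (κεΔ + 2ρ²) / (εΔ)²`.
  have hcK : c ≤ Cα * E.Kstar Θ (θ₁ - y) θlow := by
    rw [← div_div, div_le_iff₀ hKpos] at hCα
    refine le_of_eq_of_le ?_ hCα
    rw [hcdef, hydef]
    field_simp
    ring
  set M := max (16 * (κ * ε * Δ + 2 * ρ ^ 2) / (ε * (θ₁ - θa)) ^ 2)
    (Cα * E.Kstar Θ (θ₁ - x) (θa + x)) with hM
  have hM0 : 0 ≤ M := le_max_of_le_right (mul_nonneg hCα_pos.le (ExpFamily.Kstar_nonneg _ _))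
  have hq : 0 ≤ M * Real.log T := mul_nonneg hM0 (Real.log_natCast_nonneg T)
  set U : ℕ → Set Ω := fun t => deviationEvent arm X θa c x 1 a t
  set V : ℕ → Set Ω := fun t => deviationEvent arm X θ₁ c x (-1) best t
  have hUm : ∀ t, MeasurableSet (U t) := fun t => hb.measurableSet_deviationEvent _ _ _ _ _ _
  have hVm : ∀ t, MeasurableSet (V t) := fun t => hb.measurableSet_deviationEvent _ _ _ _ _ _
  have hUi : ∀ t, Integrable ((U t).indicator (1 : Ω → ℝ)) P :=
    fun t => (integrable_const (1 : ℝ)).indicator (hUm t)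
  have hVi : ∀ t, Integrable ((V t).indicator (1 : Ω → ℝ)) P :=
    fun t => (integrable_const (1 : ℝ)).indicator (hVm t)
  have hle : ∀ᵐ ω ∂P, (pulls arm a T ω : ℝ) ≤ M * Real.log T + 1 + ∑ t ∈ Finset.range T,
      ((U t).indicator (1 : Ω → ℝ) ω + (V t).indicator (1 : Ω → ℝ) ω) := by
    filter_upwards [hpol, hb.ae_reward_mem hD_mem] with ω hω hX
    refine (pulls_le arm a ω hq T).trans (by
      gcongr with t ht
      have hU0 : 0 ≤ (U t).indicator (1 : Ω → ℝ) ω :=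
        Set.indicator_nonneg (fun _ _ => zero_le_one) _
      have hV0 : 0 ≤ (V t).indicator (1 : Ω → ℝ) ω :=
        Set.indicator_nonneg (fun _ _ => zero_le_one) _
      split_ifs with h
      · have hlogle : Real.log ((t + 1 : ℕ) : ℝ) ≤ Real.log T :=
          Real.log_le_log (by positivity) (by exact_mod_cast Finset.mem_range.1 ht)
        have hN : Cα * E.Kstar Θ (θ₁ - x) (θa + x) * Real.log ((t + 1 : ℕ) : ℝ) <
            pulls arm a t ω :=
          (mul_le_mul (le_max_right _ _) hlogle (Real.log_natCast_nonneg _) hM0).trans_lt h.2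
        rcases hω.mem_deviationEvent hS hI hc hlow hCα_pos hX hθ₁ hθa hy hyx hgap hcK
          (best := best) h.1 hN with hmem | hmem
        · have : (U t).indicator (1 : Ω → ℝ) ω = 1 := Set.indicator_of_mem hmem _
          linarith
        · have : (V t).indicator (1 : Ω → ℝ) ω = 1 := Set.indicator_of_mem hmem _
          linarith
      · positivity)
  have hsumi : Integrable (fun ω => ∑ t ∈ Finset.range T,
      ((U t).indicator (1 : Ω → ℝ) ω + (V t).indicator (1 : Ω → ℝ) ω)) P :=
    integrable_finsetSum _ fun t _ => (hUi t).add (hVi t)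
  have hprob : ∀ t, P.real (U t) + P.real (V t) ≤ 2 * (1 / ((t + 1 : ℕ) : ℝ) ^ 2) := fun t => by
    have h1 := hb.measureReal_deviationEvent_le a (hsub a) hκ (σ := 1) (by simp) hy hyx t
    have h2 := hb.measureReal_deviationEvent_le best (hsub best) hκ (σ := -1) (by simp) hy hyx t
    linarith
  calc ∫ ω, (pulls arm a T ω : ℝ) ∂P
      ≤ ∫ ω, (M * Real.log T + 1 + ∑ t ∈ Finset.range T,
          ((U t).indicator (1 : Ω → ℝ) ω + (V t).indicator (1 : Ω → ℝ) ω)) ∂P :=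
        integral_mono_ae (hb.integrable_pulls a T) ((integrable_const _).add hsumi) hle
    _ = M * Real.log T + 1 + ∑ t ∈ Finset.range T, (P.real (U t) + P.real (V t)) := by
        rw [integral_add (integrable_const _) hsumi]
        congr 1
        · simp
        · refine (integral_finsetSum _ fun t _ => (hUi t).add (hVi t)).trans ?_
          refine Finset.sum_congr rfl fun t _ => ?_
          rw [integral_add' (hUi t) (hVi t), integral_indicator_one (hUm t),
            integral_indicator_one (hVm t)]
    _ ≤ M * Real.log T + 1 + ∑ t ∈ Finset.range T, 2 * (1 / ((t + 1 : ℕ) : ℝ) ^ 2) := by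
        gcongr with t _
        exact hprob t
    _ ≤ M * Real.log T + 1 + Real.pi ^ 2 / 3 := by
        rw [← Finset.mul_sum]
        linarith [sum_range_one_div_sq_le T]

end Regret

lemma Qtilde_isBigO (E : ExpFamily) (Θ : Set ℝ) (ρ κ ε Cα θ₁ Δ θa b : ℝ) :
    (fun T : ℕ => Qtilde E Θ ρ κ ε Cα θ₁ Δ θa T + b) =O[atTop] fun T : ℕ => Real.log T := by
  have hconst : ∀ d : ℝ, (fun _ : ℕ => d) =O[atTop] fun T : ℕ => Real.log T := fun d =>
    (Real.isLittleO_const_log_atTop.comp_tendsto tendsto_natCast_atTop_atTop).isBigO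
  exact (((isBigO_refl _ _).const_mul_left _).add (hconst 1)).add (hconst b)

end RBMLE

/-! ### Assembly of the regret bound. -/

theorem mainTheorem6
    {m : ℕ} {Ω : Type*} [MeasurableSpace Ω] (P : Measure Ω) [IsProbabilityMeasure P]
    (ℱ : Filtration ℕ (inferInstance : MeasurableSpace Ω))
    (D : Fin (m + 2) → Measure ℝ) [∀ i, IsProbabilityMeasure (D i)]
    (arm : ℕ → Ω → Fin (m + 2)) (X : ℕ → Ω → ℝ)
    (hbandit : RBMLE.IsBandit P ℱ D arm X)
    (E : RBMLE.ExpFamily) (Θ : Set ℝ) (θlow : ℝ)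
    (hΘ_sub : Θ ⊆ E.meanSpace) (hΘ_interval : Θ.OrdConnected) (hΘ_closed : IsClosed Θ)
    (hθlow : IsLeast Θ θlow)
    (hD_mem : ∀ i, ∀ᵐ x ∂(D i), x ∈ Θ)
    (ρ κ : ℝ) (hρ : 0 ≤ ρ) (hκ : 0 ≤ κ)
    (hD_subexp : ∀ i, RBMLE.IsSubExponential (D i) ρ κ)
    (hbest : RBMLE.armMean D 1 < RBMLE.armMean D 0)
    (hsorted : Antitone (RBMLE.armMean D))
    (θ₁ Δ : ℝ) (hθ₁ : θ₁ = RBMLE.armMean D 0) (hΔ : Δ = θ₁ - RBMLE.armMean D 1)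
    (ε : ℝ) (hε_pos : 0 < ε) (hε_lt : ε < 1)
    (Cα : ℝ) (hCα_pos : 0 < Cα)
    (hCα : 16 * (κ * ε * Δ + 2 * ρ ^ 2) /
      ((ε * Δ) ^ 2 * E.Kstar Θ (θ₁ - ε * Δ / 2) θlow) ≤ Cα)
    (hpolicy : ∀ᵐ ω ∂P,
      RBMLE.FollowsRBMLE E Θ (fun t => Cα * Real.log t) arm X ω) :
    (∀ T : ℕ, 1 ≤ T →
      RBMLE.regret P D X 0 T ≤
        ∑ a ∈ Finset.univ.erase (0 : Fin (m + 2)),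
          (θ₁ - RBMLE.armMean D a) *
            (RBMLE.Qtilde E Θ ρ κ ε Cα θ₁ Δ (RBMLE.armMean D a) T + Real.pi ^ 2 / 3)) ∧
    (fun T : ℕ => RBMLE.regret P D X 0 T) =O[atTop] (fun T : ℕ => Real.log T) := by
  have hmem : ∀ i, RBMLE.armMean D i ∈ Θ := fun i =>
    hΘ_interval.convex.integral_mem hΘ_closed (hD_mem i) (hD_subexp i).1
  have hΔ_pos : 0 < Δ := by rw [hΔ, hθ₁]; exact sub_pos.2 hbest
  have hgap : ∀ a ≠ (0 : Fin (m + 2)), Δ ≤ θ₁ - RBMLE.armMean D a := fun a ha => by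
    have h1 : (1 : Fin (m + 2)) ≤ a := Fin.one_le_of_ne_zero ha
    rw [hΔ]
    linarith [hsorted h1]
  have hreg : ∀ T, RBMLE.regret P D X 0 T = ∑ a ∈ Finset.univ.erase (0 : Fin (m + 2)),
      (θ₁ - RBMLE.armMean D a) * ∫ ω, (RBMLE.pulls arm a T ω : ℝ) ∂P := fun T => by
    rw [hbandit.regret_eq (fun i => (hD_subexp i).1), hθ₁,
      ← Finset.add_sum_erase _ _ (Finset.mem_univ 0), sub_self, zero_mul, zero_add]
  have hbound : ∀ T : ℕ, RBMLE.regret P D X 0 T ≤ ∑ a ∈ Finset.univ.erase (0 : Fin (m + 2)),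
      (θ₁ - RBMLE.armMean D a) *
        (RBMLE.Qtilde E Θ ρ κ ε Cα θ₁ Δ (RBMLE.armMean D a) T + Real.pi ^ 2 / 3) := fun T => by
    rw [hreg]
    refine Finset.sum_le_sum fun a ha => ?_
    have hga := hgap a (Finset.ne_of_mem_erase ha)
    refine mul_le_mul_of_nonneg_left ?_ (hΔ_pos.le.trans hga)
    subst hθ₁
    exact hbandit.integral_pulls_le hΘ_sub hΘ_interval hΘ_closed hθlow hD_mem (hmem 0) (hmem a) hκ
      hD_subexp hΔ_pos hga hε_pos hε_lt hCα_pos hCα hpolicy T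
  refine ⟨fun T _ => hbound T, ?_⟩
  have hO : (fun T : ℕ => ∑ a ∈ Finset.univ.erase (0 : Fin (m + 2)), (θ₁ - RBMLE.armMean D a) *
      (RBMLE.Qtilde E Θ ρ κ ε Cα θ₁ Δ (RBMLE.armMean D a) T + Real.pi ^ 2 / 3)) =O[atTop]
      fun T : ℕ => Real.log T :=
    IsBigO.fun_sum fun a _ => (RBMLE.Qtilde_isBigO _ _ _ _ _ _ _ _ _ _).const_mul_left _
  refine IsBigO.trans (IsBigO.of_norm_le fun T => ?_) hO
  -- The upper bound controls the norm because the regret is a sum of nonnegative terms.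
  rw [Real.norm_of_nonneg]
  · exact hbound T
  · rw [hreg]
    exact Finset.sum_nonneg fun a ha => mul_nonneg
      (hΔ_pos.le.trans (hgap a (Finset.ne_of_mem_erase ha)))
      (integral_nonneg fun _ => Nat.cast_nonneg _)
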